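/- A function $f_0\colon\mathbb{R}\to[0,\infty)$ belongs to $\mathcal{F}$ if it is a continuous, log-concave probability density on $\mathbb{R}$. For $f_0\in\mathcal{F}$, let $\psi_0$ be its score function, i.e. the right derivative of $\log f_0$ on $\{f_0>0\}$, with $\psi_0:=\infty$ to the left and $\psi_0:=-\infty$ to the right of this support, and let $F_0^{-1}(u):=\inf\{x: F_0(x)\ge u\}$ be the quantile function of $f_0$, where $F_0$ is its distribution function. The Fisher information of $f_0$ is $i(f_0):=\int_{-\infty}^\infty\psi_0^2f_0$, and the loss of a score estimate $\hat\psi\colon\mathbb{R}\to\mathbb{R}$ is $\mathcal{L}(\hat\psi,\psi_0):=\int_{-\infty}^\infty(\hat\psi-\psi_0)^2f_0$ (with $0\times\infty:=0$). For $n\in\mathbb{N}=\{1,2,\dots\}$, let $\hat\Psi_n$ be the set of jointly measurable functions $\hat\psi_n\colon\mathbb{R}\times\mathbb{R}^n\to\mathbb{R}$, and let $X_1,\dots,X_n$ be independent with density $f_0$ under $\mathbb{P}_{f_0}$. For $\mathcal{G}\subseteq\mathcal{F}$ and $\delta\in(0,1]$, define the minimax risk and the minimax $(1-\delta)$th quantile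 $$\mathcal{M}_n(\mathcal{G}):=\inf_{\hat\psi_n\in\hat\Psi_n}\sup_{f_0\in\mathcal{G}}\mathbb{E}_{f_0}\,\mathcal{L}\bigl(\hat\psi_n(\cdot;X_1,\dots,X_n),\psi_0\bigr),$$ $$\mathcal{M}_n(\delta,\mathcal{G}):=\inf_{\hat\psi_n\in\hat\Psi_n}\sup_{f_0\in\mathcal{G}}\inf\Bigl\{t\in[0,\infty):\mathbb{P}_{f_0}\bigl\{\mathcal{L}\bigl(\hat\psi_n(\cdot;X_1,\dots,X_n),\psi_0\bigr)\le t\bigr\}\ge1-\delta\Bigr\},\qquad \inf\emptyset:=\infty.$$ For $\gamma\in(0,1]$ and $L,r>0$, let $\mathcal{J}_{\gamma,L,r}$ be the set of $f_0\in\mathcal{F}$ with $i(f_0)\le r$ and $$\bigl|\psi_0\bigl(F_0^{-1}(u)\bigr)\bigr|\le\frac{L}{\{u\wedge(1-u)\}^{(1-\gamma)/2}}\qquad\text{for all }u\in(0,1).$$ **Theorem 3.** For every $\gamma\in(0,1]$ there is a constant $c_\gamma>0$, depending only on $\gamma$, such that for all $n\in\mathbb{N}$, $\delta\in(0,1/4]$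 and $L,r>0$, with $\bar r:=r\wedge L^2$, $$\mathcal{M}_n(\delta,\mathcal{J}_{\gamma,L,r})\ge c_\gamma\,\bar r\min\biggl\{\Bigl(\frac{L^{2/\gamma}}{\bar r^{1/\gamma}}\cdot\frac{\log(1/\delta)}{n}\Bigr)^{\gamma\wedge\frac13},\,1\biggr\} \quad\text{and}\quad \mathcal{M}_n(\mathcal{J}_{\gamma,L,r})\ge c_\gamma\,\bar r\min\biggl\{\Bigl(\frac{L^{2/\gamma}}{\bar r^{1/\gamma}}\cdot\frac1n\Bigr)^{\gamma\wedge\frac13},\,1\biggr\}.$$ -/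

import Mathlib

open MeasureTheory
open scoped ENNReal

noncomputable section

namespace ScoreEstimation

/-- The class of continuous, log-concave (Lebesgue probability) densities on the real line.
Log-concavity means that the support `{f > 0}` is convex and that `log f` is concave on it, i.e.
`log f`, with value minus infinity off the support, is concave on the real line. -/
structure IsLogConcaveDensity (f : ℝ → ℝ) : Prop where
  nonneg : ∀ x, 0 ≤ f x
  continuous : Continuous f
  lintegral_eq_one : ∫⁻ x, ENNReal.ofReal (f x) = 1
  concaveOn_log : ConcaveOn ℝ {x | 0 < f x} (fun x => Real.log (f x))

/-- The distribution with Lebesgue density `f`. -/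
def law (f : ℝ → ℝ) : Measure ℝ :=
  volume.withDensity (fun x => ENNReal.ofReal (f x))

/-- The quantile function `u ↦ inf {x : u ≤ F x}`, for `u` in `(0, 1)`, where `F` is the
distribution function of the distribution with density `f`. -/
def quantile (f : ℝ → ℝ) (u : ℝ) : ℝ :=
  sInf {x : ℝ | u ≤ ProbabilityTheory.cdf (law f) x}

open Classical in
/-- The score function of a log-concave density `f`, in its right-continuous version: the right
derivative of `log f` on the support of `f`, `+∞` to the left of the support and `-∞` to the right
of it. Any other version (any selection between the right and left derivatives of `log f` on the
support) differs from it on an at most countable set. -/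
def score (f : ℝ → ℝ) (x : ℝ) : EReal :=
  if 0 < f x then ((derivWithin (fun y => Real.log (f y)) (Set.Ioi x) x : ℝ) : EReal)
  else if ∀ y, 0 < f y → x ≤ y then ⊤ else ⊥

/-- The Fisher information for location, the integral of `ψ ^ 2 * f` with `ψ` the score of `f`
(with the convention `∞ * 0 = 0` off the support). -/
def fisherInfo (f : ℝ → ℝ) : ℝ≥0∞ :=
  ∫⁻ x, (score f x).abs ^ 2 * ENNReal.ofReal (f x)

/-- The loss of a score estimate `g` when the true density is `f`: the integral of
`(g - ψ) ^ 2 * f` with `ψ` the score of `f` (with the convention `∞ * 0 = 0` off the support). -/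
def loss (g : ℝ → ℝ) (f : ℝ → ℝ) : ℝ≥0∞ :=
  ∫⁻ x, ((g x : EReal) - score f x).abs ^ 2 * ENNReal.ofReal (f x)

/-- The joint distribution of `n` independent observations with density `f`. -/
def sampleLaw (n : ℕ) (f : ℝ → ℝ) : Measure (Fin n → ℝ) :=
  Measure.pi (fun _ => law f)

/-- The estimators of the score based on `n` observations: the jointly measurable functions of a
point of the real line and of the sample. -/
def estimators (n : ℕ) : Set (ℝ → (Fin n → ℝ) → ℝ) :=
  {est | Measurable (Function.uncurry est)}

/-- The expected loss of the estimator `est` when the observations have density `f`. -/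
def risk (n : ℕ) (est : ℝ → (Fin n → ℝ) → ℝ) (f : ℝ → ℝ) : ℝ≥0∞ :=
  ∫⁻ X, loss (fun x => est x X) f ∂(sampleLaw n f)

/-- The `(1 - δ)`-quantile of the loss of the estimator `est` when the observations have
density `f`; it is infinite if no finite threshold qualifies. -/
def lossQuantile (n : ℕ) (δ : ℝ) (est : ℝ → (Fin n → ℝ) → ℝ) (f : ℝ → ℝ) : ℝ≥0∞ :=
  sInf {t : ℝ≥0∞ | t ≠ ⊤ ∧
    ENNReal.ofReal (1 - δ) ≤ sampleLaw n f {X | loss (fun x => est x X) f ≤ t}}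

/-- The minimax risk of score estimation over a class `G` of densities. -/
def minimaxRisk (n : ℕ) (G : Set (ℝ → ℝ)) : ℝ≥0∞ :=
  ⨅ est ∈ estimators n, ⨆ f ∈ G, risk n est f

/-- The minimax `(1 - δ)`-quantile of the score estimation loss over a class `G` of densities. -/
def minimaxQuantile (n : ℕ) (δ : ℝ) (G : Set (ℝ → ℝ)) : ℝ≥0∞ :=
  ⨅ est ∈ estimators n, ⨆ f ∈ G, lossQuantile n δ est f

/-- The continuous log-concave densities `f`, with score `ψ` and quantile function `Q`, such that
`|ψ (Q u)| ≤ L / min(u, 1 - u) ^ ((1 - γ) / 2)` for all `u` in `(0, 1)`. Here `ψ ∘ Q` is the right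
derivative of the density quantile function `f ∘ Q`. -/
def tailClass (γ L : ℝ) : Set (ℝ → ℝ) :=
  {f | IsLogConcaveDensity f ∧ ∀ u : ℝ, 0 < u → u < 1 →
    (score f (quantile f u)).abs ≤ ENNReal.ofReal (L / (min u (1 - u)) ^ ((1 - γ) / 2))}

/-- The densities in the previous class whose Fisher information is at most `r`. -/
def tailClassFisher (γ L r : ℝ) : Set (ℝ → ℝ) :=
  {f | f ∈ tailClass γ L ∧ fisherInfo f ≤ ENNReal.ofReal r}

end ScoreEstimation

end

/-! This is a two-point argument whose base density is flat on an interval of length `ℓ` with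
exponential tails of rate `m` on both sides. The competitor cuts the corner of the potential at `0`
by a chord of slope `m / 2` over `[-s, s]`. For a tail level `v`, take `m` of order `L / v ^ ((1 -
γ) / 2)`, `ℓ = 6 / (m * v)` and `s = h / m` with `h ≤ 1`. The score then vanishes outside tails of
mass at most `v` and never exceeds `m`, so both densities lie in the class as soon as `L ^ 2 * v ^ γ
≤ r` (`gibbs_mem_tailClassFisher`).

On `[-s, 0]` the scores differ by `m / 2` while the densities are of order `m * v`, so the losses
separate by order `m ^ 2 * v * h`, that is `L ^ 2 * v ^ γ * h` (`separation_gibbs`). The squared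
affinity falls short of one by at most order `h ^ 3 * v` (`one_sub_le_sq_affinity_gibbs`), so `n`
observations cannot tell the densities apart while `n * h ^ 3 * v ≤ log (1 / δ)`. Maximising `v ^ γ
* h` under these constraints (`exists_level_width`) gives the exponent `min γ (1 / 3)`. -/

noncomputable section

namespace ScoreEstimation

/-! ### Hellinger affinity and tests between two densities. -/

section Testing

variable {α : Type*} [MeasurableSpace α] {μ : Measure α}

lemma integrable_sqrt_mul {p q : α → ℝ} (hp : Integrable p μ) (hq : Integrable q μ)
    (hp0 : ∀ x, 0 ≤ p x) (hq0 : ∀ x, 0 ≤ q x) :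
    Integrable (fun x => √(p x * q x)) μ := by
  refine (hp.add hq).mono' ?_ (.of_forall fun x => ?_)
  · exact (Real.continuous_sqrt.comp_aestronglyMeasurable
      (hp.aestronglyMeasurable.mul hq.aestronglyMeasurable))
  · rw [Real.norm_of_nonneg (Real.sqrt_nonneg _), Pi.add_apply]
    refine (Real.sqrt_le_left (add_nonneg (hp0 x) (hq0 x))).2 ?_
    nlinarith [hp0 x, hq0 x, mul_nonneg (hp0 x) (hq0 x)]

/-- The Cauchy–Schwarz inequality for the Hellinger affinity. -/
lemma sq_integral_sqrt_mul_le {p q : α → ℝ} (hp : Integrable p μ) (hq : Integrable q μ)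
    (hp0 : ∀ x, 0 ≤ p x) (hq0 : ∀ x, 0 ≤ q x) :
    (∫ x, √(p x * q x) ∂μ) ^ 2 ≤ (∫ x, p x ∂μ) * ∫ x, q x ∂μ := by
  have hs := integrable_sqrt_mul hp hq hp0 hq0
  have key : ∀ t : ℝ, 0 ≤ (∫ x, p x ∂μ) * (t * t) + (-2 * ∫ x, √(p x * q x) ∂μ) * t
      + ∫ x, q x ∂μ := by
    intro t
    have h : (∫ x, p x ∂μ) * (t * t) + (-2 * ∫ x, √(p x * q x) ∂μ) * t + ∫ x, q x ∂μ
        = ∫ x, (p x * (t * t) + √(p x * q x) * (-2 * t) + q x) ∂μ := by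
      have hadd : Integrable (fun x => p x * (t * t) + √(p x * q x) * (-2 * t)) μ :=
        (hp.mul_const _).add (hs.mul_const _)
      rw [integral_add hadd hq,
        integral_add (hp.mul_const _) (hs.mul_const _), integral_mul_const, integral_mul_const]
      ring
    rw [h]
    refine integral_nonneg fun x => ?_
    have e : p x * (t * t) + √(p x * q x) * (-2 * t) + q x = (√(p x) * t - √(q x)) ^ 2 := by
      rw [Real.sqrt_mul (hp0 x)]
      nlinarith [Real.mul_self_sqrt (hp0 x), Real.mul_self_sqrt (hq0 x)]
    simp only [Pi.zero_apply, e]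
    positivity
  have := discrim_le_zero key
  unfold discrim at this
  nlinarith

/-- A test with both error probabilities at most `δ` bounds the Hellinger affinity. -/
lemma sq_affinity_le_of_test {p q : α → ℝ} (hp : Integrable p μ) (hq : Integrable q μ)
    (hp0 : ∀ x, 0 ≤ p x) (hq0 : ∀ x, 0 ≤ q x) (hp1 : ∫ x, p x ∂μ = 1) (hq1 : ∫ x, q x ∂μ = 1)
    {A : Set α} (hA : MeasurableSet A) {δ : ℝ} (hδ : δ ≤ 1 / 2)
    (h1 : ∫ x in Aᶜ, p x ∂μ ≤ δ) (h2 : ∫ x in A, q x ∂μ ≤ δ) :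
    (∫ x, √(p x * q x) ∂μ) ^ 2 ≤ 4 * δ * (1 - δ) := by
  have hmin : Integrable (fun x => min (p x) (q x)) μ := hp.inf hq
  have hmax : Integrable (fun x => max (p x) (q x)) μ := hp.sup hq
  have hsum : (∫ x, min (p x) (q x) ∂μ) + ∫ x, max (p x) (q x) ∂μ = 2 := by
    rw [← integral_add hmin hmax]
    simp_rw [min_add_max]
    rw [integral_add hp hq, hp1, hq1]
    norm_num
  have hle : ∫ x, min (p x) (q x) ∂μ ≤ 2 * δ := by
    rw [← integral_add_compl hA hmin]
    have a := setIntegral_mono hmin.integrableOn hq.integrableOn (s := A)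
      (fun x => min_le_right (p x) (q x))
    have b := setIntegral_mono hmin.integrableOn hp.integrableOn (s := Aᶜ)
      (fun x => min_le_left (p x) (q x))
    linarith
  -- Since `p * q = min * max`, Cauchy–Schwarz gives `a * (2 - a)` with `a` the integral of the
  -- minimum. This is increasing for `a ≤ 1`, and `a ≤ 2 * δ ≤ 1`. Unlike a total variation bound
  -- linear in the affinity, it keeps the `log (1 / δ)` dependence.
  have cs := sq_integral_sqrt_mul_le hmin hmax (fun x => le_min (hp0 x) (hq0 x))
    (fun x => le_max_of_le_left (hp0 x))
  simp_rw [min_mul_max] at cs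
  nlinarith

end Testing

/-! ### Scores and losses of positive densities. -/

/-- The score of a positive density, as a real function. -/
def realScore (f : ℝ → ℝ) (x : ℝ) : ℝ :=
  derivWithin (fun y => Real.log (f y)) (Set.Ioi x) x

lemma score_eq {f : ℝ → ℝ} (hf : ∀ x, 0 < f x) (x : ℝ) : score f x = (realScore f x : EReal) := by
  simp [score, hf x, realScore]

lemma measurable_realScore (f : ℝ → ℝ) : Measurable (realScore f) :=
  measurable_derivWithin_Ioi _

lemma abs_coe_sq (y : ℝ) : (y : EReal).abs ^ 2 = ENNReal.ofReal (y ^ 2) := by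
  rw [EReal.abs_def, ← ENNReal.ofReal_pow (abs_nonneg _), sq_abs]

lemma loss_eq {f : ℝ → ℝ} (hf : ∀ x, 0 < f x) (g : ℝ → ℝ) :
    loss g f = ∫⁻ x, ENNReal.ofReal ((g x - realScore f x) ^ 2 * f x) := by
  unfold loss
  refine lintegral_congr fun x => ?_
  rw [score_eq hf, ← EReal.coe_sub, abs_coe_sq, ← ENNReal.ofReal_mul (sq_nonneg _)]

lemma fisherInfo_eq {f : ℝ → ℝ} (hf : ∀ x, 0 < f x) :
    fisherInfo f = ∫⁻ x, ENNReal.ofReal (realScore f x ^ 2 * f x) := by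
  unfold fisherInfo
  refine lintegral_congr fun x => ?_
  rw [score_eq hf, abs_coe_sq, ← ENNReal.ofReal_mul (sq_nonneg _)]

lemma measurable_loss {n : ℕ} {f : ℝ → ℝ} (hf : ∀ x, 0 < f x) (hfm : Measurable f)
    {est : ℝ → (Fin n → ℝ) → ℝ} (hest : est ∈ estimators n) :
    Measurable fun X => loss (fun x => est x X) f := by
  simp_rw [loss_eq hf]
  refine Measurable.lintegral_prod_right' (f := fun z : (Fin n → ℝ) × ℝ =>
    ENNReal.ofReal ((est z.2 z.1 - realScore f z.2) ^ 2 * f z.2)) ?_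
  have h : Measurable fun z : (Fin n → ℝ) × ℝ => est z.2 z.1 :=
    (show Measurable (Function.uncurry est) from hest).comp measurable_swap
  exact ((((h.sub ((measurable_realScore f).comp measurable_snd)).pow_const 2)).mul
    (hfm.comp measurable_snd)).ennreal_ofReal

/-- No estimate is close to two scores that differ on an interval where both densities are
bounded away from zero. -/
lemma separation_le_loss_add_loss {f g : ℝ → ℝ} (hf : ∀ x, 0 < f x) (hg : ∀ x, 0 < g x)
    (hgm : Measurable g) {a b D B : ℝ} (hD0 : 0 ≤ D) (hB0 : 0 ≤ B)
    (hD : ∀ x ∈ Set.Ioo a b, D ≤ |realScore f x - realScore g x|)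
    (hBf : ∀ x ∈ Set.Ioo a b, B ≤ f x) (hBg : ∀ x ∈ Set.Ioo a b, B ≤ g x)
    {e : ℝ → ℝ} (he : Measurable e) :
    ENNReal.ofReal (D ^ 2 * B / 2 * (b - a)) ≤ loss e f + loss e g := by
  have hm : Measurable fun x => ENNReal.ofReal ((e x - realScore g x) ^ 2 * g x) :=
    (((he.sub (measurable_realScore g)).pow_const 2).mul hgm).ennreal_ofReal
  rw [loss_eq hf, loss_eq hg, ← lintegral_add_right _ hm]
  calc ENNReal.ofReal (D ^ 2 * B / 2 * (b - a))
      = ∫⁻ _ in Set.Ioo a b, ENNReal.ofReal (D ^ 2 * B / 2) := by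
        rw [setLIntegral_const, Real.volume_Ioo, ENNReal.ofReal_mul (by positivity)]
    _ ≤ ∫⁻ x in Set.Ioo a b, (ENNReal.ofReal ((e x - realScore f x) ^ 2 * f x)
          + ENNReal.ofReal ((e x - realScore g x) ^ 2 * g x)) := by
        refine setLIntegral_mono' measurableSet_Ioo fun x hx => ?_
        rw [← ENNReal.ofReal_add (mul_nonneg (sq_nonneg _) (hf x).le)
          (mul_nonneg (sq_nonneg _) (hg x).le)]
        refine ENNReal.ofReal_le_ofReal ?_
        have h1 : D ^ 2 ≤ (realScore f x - realScore g x) ^ 2 := by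
          rw [← sq_abs (realScore f x - realScore g x)]
          exact pow_le_pow_left₀ hD0 (hD x hx) 2
        have h2 := mul_le_mul_of_nonneg_left (hBf x hx) (sq_nonneg (e x - realScore f x))
        have h3 := mul_le_mul_of_nonneg_left (hBg x hx) (sq_nonneg (e x - realScore g x))
        have h4 : D ^ 2 / 2 ≤ (e x - realScore f x) ^ 2 + (e x - realScore g x) ^ 2 := by
          nlinarith [sq_nonneg ((e x - realScore f x) + (e x - realScore g x))]
        nlinarith [mul_le_mul_of_nonneg_right h4 hB0]
    _ ≤ _ := setLIntegral_le_lintegral _ _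

/-! ### Product densities and the two-point reduction. -/

/-- A positive, continuous function of integral one. -/
structure IsPositiveDensity (f : ℝ → ℝ) : Prop where
  pos : ∀ x, 0 < f x
  continuous : Continuous f
  integrable : Integrable f
  integral_eq_one : ∫ x, f x = 1

namespace IsPositiveDensity

variable {f g : ℝ → ℝ}

lemma law_apply (hf : IsPositiveDensity f) {s : Set ℝ} (hs : MeasurableSet s) :
    law f s = ENNReal.ofReal (∫ x in s, f x) := by
  rw [law, withDensity_apply _ hs, ofReal_integral_eq_lintegral_ofReal hf.integrable.integrableOn
    (.of_forall fun x => (hf.pos x).le)]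

lemma isProbabilityMeasure_law (hf : IsPositiveDensity f) : IsProbabilityMeasure (law f) :=
  ⟨by rw [hf.law_apply .univ]; simp [hf.integral_eq_one]⟩

lemma integrable_prod (hf : IsPositiveDensity f) (n : ℕ) :
    Integrable fun X : Fin n → ℝ => ∏ i, f (X i) :=
  Integrable.fintype_prod (f := fun _ => f) fun _ => hf.integrable

lemma integral_prod_eq_one (hf : IsPositiveDensity f) (n : ℕ) :
    ∫ X : Fin n → ℝ, ∏ i, f (X i) = 1 := by
  have := integral_fintype_prod_volume_eq_prod (ι := Fin n) (fun _ => f)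
  rw [this]
  simp [hf.integral_eq_one]

lemma sampleLaw_apply (hf : IsPositiveDensity f) (n : ℕ) {s : Set (Fin n → ℝ)}
    (hs : MeasurableSet s) :
    sampleLaw n f s = ENNReal.ofReal (∫ X in s, ∏ i, f (X i)) := by
  have := hf.isProbabilityMeasure_law
  have hpos : ∀ X : Fin n → ℝ, 0 ≤ ∏ i, f (X i) := fun X =>
    Finset.prod_nonneg fun i _ => (hf.pos _).le
  have key : sampleLaw n f
      = (volume : Measure (Fin n → ℝ)).withDensity fun X => ENNReal.ofReal (∏ i, f (X i)) := by
    refine Measure.pi_eq fun t ht => ?_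
    rw [withDensity_apply _ (MeasurableSet.univ_pi ht),
      ← ofReal_integral_eq_lintegral_ofReal (hf.integrable_prod n).integrableOn
      (.of_forall hpos), volume_pi, Measure.restrict_pi_pi,
      integral_fintype_prod_eq_prod (fun _ => f),
      ENNReal.ofReal_prod_of_nonneg fun i _ => integral_nonneg fun x => (hf.pos x).le]
    exact Finset.prod_congr rfl fun i _ => (hf.law_apply (ht i)).symm
  rw [key, withDensity_apply _ hs, ofReal_integral_eq_lintegral_ofReal
    (hf.integrable_prod n).integrableOn (.of_forall hpos)]

lemma isProbabilityMeasure_sampleLaw (hf : IsPositiveDensity f) (n : ℕ) :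
    IsProbabilityMeasure (sampleLaw n f) :=
  ⟨by rw [hf.sampleLaw_apply n .univ]; simp [hf.integral_prod_eq_one]⟩

lemma affinity_prod (hf : IsPositiveDensity f) (hg : IsPositiveDensity g) (n : ℕ) :
    ∫ X : Fin n → ℝ, √((∏ i, f (X i)) * ∏ i, g (X i)) = (∫ x, √(f x * g x)) ^ n := by
  have h : ∀ X : Fin n → ℝ, √((∏ i, f (X i)) * ∏ i, g (X i))
      = ∏ i, (fun x => √(f x * g x)) (X i) := by
    intro X
    rw [← Finset.prod_mul_distrib, Real.sqrt_prod]
    exact fun i _ => mul_nonneg (hf.pos _).le (hg.pos _).le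
  simp_rw [h]
  have := integral_fintype_prod_volume_eq_prod (ι := Fin n) (fun _ => fun x => √(f x * g x))
  rw [this]
  simp

/-- Two densities with large Hellinger affinity and well separated scores: no estimator has a
small loss with high probability under both. -/
lemma exists_sampleLaw_loss_lt (hf : IsPositiveDensity f) (hg : IsPositiveDensity g) {n : ℕ}
    {δ : ℝ} (hδ : δ ≤ 1 / 2)
    (haff : 4 * δ * (1 - δ) < ((∫ x, √(f x * g x)) ^ 2) ^ n) {T : ℝ≥0∞}
    (hsep : ∀ e : ℝ → ℝ, Measurable e → 2 * T ≤ loss e f + loss e g)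
    {est : ℝ → (Fin n → ℝ) → ℝ} (hest : est ∈ estimators n) {t : ℝ≥0∞} (ht : t < T) :
    ∃ h ∈ ({f, g} : Set (ℝ → ℝ)),
      sampleLaw n h {X | loss (fun x => est x X) h ≤ t} < ENNReal.ofReal (1 - δ) := by
  by_contra! hcon
  have hAf := hcon f (by simp)
  have hAg := hcon g (by simp)
  have mf : MeasurableSet {X | loss (fun x => est x X) f ≤ t} :=
    measurable_loss hf.pos hf.continuous.measurable hest measurableSet_Iic
  have mg : MeasurableSet {X | loss (fun x => est x X) g ≤ t} :=
    measurable_loss hg.pos hg.continuous.measurable hest measurableSet_Iic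
  set A := {X | loss (fun x => est x X) f ≤ t} with hA
  set A' := {X | loss (fun x => est x X) g ≤ t} with hA'
  -- The two small-loss events are disjoint by separation, so `A` is a test between `f` and `g` with
  -- both errors at most `δ`.
  have hsub : A' ⊆ Aᶜ := by
    intro X hX hX'
    have hm : Measurable fun x => est x X :=
      (show Measurable (Function.uncurry est) from hest).comp measurable_prodMk_right
    have h1 := (hsep _ hm).trans (add_le_add hX' hX)
    rw [← two_mul] at h1
    exact absurd ((ENNReal.mul_le_mul_iff_right (by simp) (by simp)).1 h1) (not_le.2 ht)
  have pf : 1 - δ ≤ ∫ X in A, ∏ i, f (X i) := by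
    rw [hf.sampleLaw_apply n mf] at hAf
    exact (ENNReal.ofReal_le_ofReal_iff (integral_nonneg fun X =>
      Finset.prod_nonneg fun i _ => (hf.pos _).le)).1 hAf
  have pg : 1 - δ ≤ ∫ X in Aᶜ, ∏ i, g (X i) := by
    have := hAg.trans (measure_mono hsub)
    rw [hg.sampleLaw_apply n mf.compl] at this
    exact (ENNReal.ofReal_le_ofReal_iff (integral_nonneg fun X =>
      Finset.prod_nonneg fun i _ => (hg.pos _).le)).1 this
  have cf := integral_add_compl mf (hf.integrable_prod n)
  have cg := integral_add_compl mf (hg.integrable_prod n)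
  rw [hf.integral_prod_eq_one] at cf
  rw [hg.integral_prod_eq_one] at cg
  have := sq_affinity_le_of_test (hf.integrable_prod n) (hg.integrable_prod n)
    (fun X => Finset.prod_nonneg fun i _ => (hf.pos _).le)
    (fun X => Finset.prod_nonneg fun i _ => (hg.pos _).le)
    (hf.integral_prod_eq_one n) (hg.integral_prod_eq_one n) mf hδ
    (by linarith) (by linarith)
  rw [affinity_prod hf hg, ← pow_mul, mul_comm n 2, pow_mul] at this
  linarith

lemma le_minimaxQuantile (hf : IsPositiveDensity f) (hg : IsPositiveDensity g) {n : ℕ}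
    {δ : ℝ} (hδ : δ ≤ 1 / 2)
    (haff : 4 * δ * (1 - δ) < ((∫ x, √(f x * g x)) ^ 2) ^ n) {T : ℝ≥0∞}
    (hsep : ∀ e : ℝ → ℝ, Measurable e → 2 * T ≤ loss e f + loss e g)
    {G : Set (ℝ → ℝ)} (hfG : f ∈ G) (hgG : g ∈ G) : T ≤ minimaxQuantile n δ G := by
  refine le_iInf₂ fun est hest => le_of_forall_lt fun t ht => ?_
  -- An infimum only yields a weak inequality `t' ≤ _`; the room between `t` and `t'` makes it
  -- strict.
  obtain ⟨t', htt', ht'⟩ := exists_between ht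
  obtain ⟨h, hh, hlt⟩ := exists_sampleLaw_loss_lt hf hg hδ haff hsep hest ht'
  have hG : h ∈ G := by
    rcases hh with rfl | rfl
    · exact hfG
    · exact hgG
  refine htt'.trans_le (le_trans ?_ (le_iSup₂_of_le h hG le_rfl))
  refine le_sInf fun u hu => ?_
  by_contra! hlt'
  refine absurd (hu.2.trans (measure_mono fun X hX => ?_)) (not_le.2 hlt)
  exact le_trans (show loss _ _ ≤ u from hX) hlt'.le

/-- Markov's inequality: under one of the two densities the loss exceeds `t'` with probability at
least `δ`. -/
lemma le_minimaxRisk (hf : IsPositiveDensity f) (hg : IsPositiveDensity g) {n : ℕ}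
    {δ : ℝ} (hδ0 : 0 < δ) (hδ : δ ≤ 1 / 2)
    (haff : 4 * δ * (1 - δ) < ((∫ x, √(f x * g x)) ^ 2) ^ n) {T : ℝ≥0∞}
    (hsep : ∀ e : ℝ → ℝ, Measurable e → 2 * T ≤ loss e f + loss e g)
    {G : Set (ℝ → ℝ)} (hfG : f ∈ G) (hgG : g ∈ G) :
    ENNReal.ofReal δ * T ≤ minimaxRisk n G := by
  have hδ' : ENNReal.ofReal δ ≠ 0 := by simpa using hδ0
  refine le_iInf₂ fun est hest => ?_
  rw [mul_comm, ← ENNReal.le_div_iff_mul_le (.inl hδ') (.inl ENNReal.ofReal_ne_top)]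
  refine le_of_forall_lt fun t ht => ?_
  obtain ⟨t', htt', ht'⟩ := exists_between ht
  obtain ⟨h, hh, hlt⟩ := exists_sampleLaw_loss_lt hf hg hδ haff hsep hest ht'
  have hG : h ∈ G ∧ IsPositiveDensity h := by
    rcases hh with rfl | rfl
    · exact ⟨hfG, hf⟩
    · exact ⟨hgG, hg⟩
  refine htt'.trans_le ?_
  rw [ENNReal.le_div_iff_mul_le (.inl hδ') (.inl ENNReal.ofReal_ne_top)]
  refine le_trans ?_ (le_iSup₂_of_le h hG.1 le_rfl)
  have hm := measurable_loss hG.2.pos hG.2.continuous.measurable hest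
  have := hG.2.isProbabilityMeasure_sampleLaw n
  have hmark := mul_meas_ge_le_lintegral (μ := sampleLaw n h) hm t'
  refine le_trans (mul_le_mul_right ?_ t') hmark
  have hc := prob_compl_eq_one_sub (μ := sampleLaw n h) (hm (measurableSet_Iic (a := t')))
  have hle : ENNReal.ofReal δ ≤ sampleLaw n h ((fun X => loss (fun x => est x X) h) ⁻¹' Set.Iic t')ᶜ := by
    rw [hc]
    refine ENNReal.le_sub_of_add_le_left (by finiteness) ?_
    refine (add_le_add_left hlt.le _).trans ?_
    rw [← ENNReal.ofReal_add (by linarith) hδ0.le]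
    simp
  refine hle.trans (measure_mono fun X hX => ?_)
  simp only [Set.mem_compl_iff, Set.mem_preimage, Set.mem_Iic, not_le] at hX
  exact hX.le

end IsPositiveDensity

/-! ### Right derivatives of Lipschitz and piecewise affine functions. -/

open Set Filter Topology in
/-- The right derivative of a function is bounded by its Lipschitz constant. -/
lemma abs_derivWithin_Ioi_le {g : ℝ → ℝ} {m : ℝ} (hm : 0 ≤ m)
    (hg : ∀ x y, |g x - g y| ≤ m * |x - y|) (x : ℝ) : |derivWithin g (Ioi x) x| ≤ m := by
  by_cases h : DifferentiableWithinAt ℝ g (Ioi x) x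
  · have ht := (hasDerivWithinAt_iff_tendsto_slope' (by simp)).1 h.hasDerivWithinAt
    refine le_of_tendsto ht.abs (eventually_mem_nhdsWithin.mono fun y hy => ?_)
    have hy' : 0 < y - x := sub_pos.2 hy
    rw [slope_def_field, abs_div, div_le_iff₀ (abs_pos.2 hy'.ne')]
    exact hg y x
  -- Without a right derivative the default value `0` satisfies the bound.
  · rw [derivWithin_zero_of_not_differentiableWithinAt h]
    simpa

open Set Filter Topology in
lemma derivWithin_Ioi_eq_of_affine {g : ℝ → ℝ} {x b k c : ℝ} (hxb : x < b)
    (hg : ∀ y ∈ Ico x b, g y = k * y + c) : derivWithin g (Ioi x) x = k := by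
  have h : HasDerivWithinAt (fun y => k * y + c) k (Ioi x) x := by
    simpa using (((hasDerivAt_id x).const_mul k).add_const c).hasDerivWithinAt
  refine (h.congr_of_eventuallyEq ?_ (hg x ⟨le_rfl, hxb⟩)).derivWithin (uniqueDiffWithinAt_Ioi x)
  filter_upwards [Ioo_mem_nhdsGT hxb] with y hy using hg y ⟨hy.1.le, hy.2⟩

/-! ### Membership in the tail class. -/

section Membership

variable {f : ℝ → ℝ} {m p q q' v : ℝ}

open Set Filter Topology in
/-- A density with small tails outside `[p, q']` satisfies, at every level, either that the
corresponding quantile lies in `[p, q)` or that the level is extreme. -/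
lemma IsPositiveDensity.quantile_mem_or_min_le (hf : IsPositiveDensity f) (hq : q' < q)
    (hl : ∫ x in Iic p, f x ≤ v) (hr : ∫ x in Ioi q', f x ≤ v) (u : ℝ) (h0 : 0 < u)
    (h1 : u < 1) : quantile f u ∈ Ico p q ∨ min u (1 - u) ≤ v := by
  have := hf.isProbabilityMeasure_law
  have cdf_eq : ∀ x, ProbabilityTheory.cdf (law f) x = ∫ y in Iic x, f y := by
    intro x
    rw [ProbabilityTheory.cdf_eq_real, measureReal_def, hf.law_apply measurableSet_Iic,
      ENNReal.toReal_ofReal (integral_nonneg fun y => (hf.pos y).le)]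
  have hne : {x : ℝ | u ≤ ProbabilityTheory.cdf (law f) x}.Nonempty := by
    obtain ⟨x, hx⟩ := ((ProbabilityTheory.tendsto_cdf_atTop (law f)).eventually
      (lt_mem_nhds h1)).exists
    exact ⟨x, hx.le⟩
  have hbdd : BddBelow {x : ℝ | u ≤ ProbabilityTheory.cdf (law f) x} := by
    obtain ⟨x, hx⟩ := ((ProbabilityTheory.tendsto_cdf_atBot (law f)).eventually
      (gt_mem_nhds h0)).exists
    refine ⟨x, fun y hy => ?_⟩
    by_contra! hlt
    exact absurd (ProbabilityTheory.monotone_cdf (law f) hlt.le) (not_le.2 (hx.trans_le hy))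
  rcases lt_or_ge (quantile f u) p with hp | hp
  · right
    obtain ⟨x, hx, hxp⟩ := exists_lt_of_csInf_lt hne hp
    have hmono := ProbabilityTheory.monotone_cdf (law f) hxp.le
    rw [cdf_eq p] at hmono
    exact (min_le_left _ _).trans ((le_trans (show u ≤ _ from hx) hmono).trans hl)
  rcases lt_or_ge (quantile f u) q with hq1 | hq1
  · exact .inl ⟨hp, hq1⟩
  · right
    -- The gap `q' < q` excludes a quantile equal to `q`, where the score may already be nonzero,
    -- unless the level is extreme.
    have hlt : ProbabilityTheory.cdf (law f) q' < u := by
      by_contra! hle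
      exact absurd (csInf_le hbdd hle) (not_le.2 (hq.trans_le hq1))
    rw [cdf_eq] at hlt
    have hc := integral_add_compl (measurableSet_Iic (a := q')) hf.integrable
    rw [compl_Iic, hf.integral_eq_one] at hc
    exact (min_le_right _ _).trans (by linarith)

open Set in
/-- A log-concave density that is flat on `[p, q)`, has score at most `m` and tails of mass at
most `v`, satisfies the tail condition and has small Fisher information. -/
lemma IsPositiveDensity.mem_tailClassFisher (hf : IsPositiveDensity f)
    (hconc : ConcaveOn ℝ univ fun x => Real.log (f x)) (hq : q' < q) (hv : 0 < v)
    (hl : ∫ x in Iic p, f x ≤ v) (hr : ∫ x in Ioi q', f x ≤ v)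
    (hflat : ∀ x ∈ Ico p q, realScore f x = 0) (hscore : ∀ x, |realScore f x| ≤ m)
    {γ L r : ℝ} (hγ : γ ≤ 1) (hL : 0 ≤ L) (hmL : m ≤ L / v ^ ((1 - γ) / 2))
    (hmr : 2 * v * m ^ 2 ≤ r) : f ∈ tailClassFisher γ L r := by
  have hsupp : {x | 0 < f x} = univ := eq_univ_of_forall hf.pos
  refine ⟨⟨⟨fun x => (hf.pos x).le, hf.continuous, ?_, by rwa [hsupp]⟩, fun u h0 h1 => ?_⟩, ?_⟩
  · rw [← ofReal_integral_eq_lintegral_ofReal hf.integrable (.of_forall fun x => (hf.pos x).le),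
      hf.integral_eq_one, ENNReal.ofReal_one]
  · rw [score_eq hf.pos, EReal.abs_def]
    refine ENNReal.ofReal_le_ofReal ?_
    have hpos : 0 < min u (1 - u) := lt_min h0 (by linarith)
    rcases hf.quantile_mem_or_min_le hq hl hr u h0 h1 with h | h
    · rw [hflat _ h, abs_zero]
      positivity
    · refine (hscore _).trans (hmL.trans ?_)
      refine div_le_div_of_nonneg_left hL (Real.rpow_pos_of_pos hpos _) ?_
      exact Real.rpow_le_rpow hpos.le h (by linarith)
  · rw [fisherInfo_eq hf.pos]
    have hi : ∀ s : Set ℝ, ∫⁻ x in s, ENNReal.ofReal (m ^ 2 * f x)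
        = ENNReal.ofReal (m ^ 2 * ∫ x in s, f x) := by
      intro s
      rw [← integral_const_mul, ofReal_integral_eq_lintegral_ofReal
        (hf.integrable.integrableOn.const_mul _)
        (.of_forall fun x => mul_nonneg (sq_nonneg _) (hf.pos x).le)]
    calc ∫⁻ x, ENNReal.ofReal (realScore f x ^ 2 * f x)
        = ∫⁻ x in Iic p ∪ Ioi q', ENNReal.ofReal (realScore f x ^ 2 * f x) := by
          refine (setLIntegral_eq_of_support_subset fun x hx => ?_).symm
          by_contra hx'
          simp only [mem_union, mem_Iic, mem_Ioi, not_or, not_le, not_lt] at hx'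
          exact hx (by simp [hflat x ⟨hx'.1.le, hx'.2.trans_lt hq⟩])
      _ ≤ ∫⁻ x in Iic p ∪ Ioi q', ENNReal.ofReal (m ^ 2 * f x) := by
          refine lintegral_mono fun x => ENNReal.ofReal_le_ofReal ?_
          refine mul_le_mul_of_nonneg_right ?_ (hf.pos x).le
          rw [← sq_abs (realScore f x)]
          exact pow_le_pow_left₀ (abs_nonneg _) (hscore x) 2
      _ ≤ ENNReal.ofReal (m ^ 2 * v) + ENNReal.ofReal (m ^ 2 * v) := by
          refine (lintegral_union_le _ _ _).trans (add_le_add ?_ ?_) <;> rw [hi] <;>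
          exact ENNReal.ofReal_le_ofReal (mul_le_mul_of_nonneg_left ‹_› (sq_nonneg m))
      _ ≤ ENNReal.ofReal r := by
          rw [← ENNReal.ofReal_add (by positivity) (by positivity)]
          exact ENNReal.ofReal_le_ofReal (by linarith)

end Membership

/-! ### The potential with and without the cut corner (`s = 0` is the base case). -/

/-- The convex potential that vanishes on `[-ℓ, -s]`, has slope `m / 2` on `[-s, s]` and slopes
`-m` and `m` further out. -/
def potential (m ℓ s x : ℝ) : ℝ :=
  max (max 0 (m / 2 * (x + s))) (max (m * x) (-(m * (x + ℓ))))

section Potential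

variable {m ℓ s x : ℝ}

lemma potential_nonneg : 0 ≤ potential m ℓ s x := by simp [potential]

lemma mul_le_potential : m * x ≤ potential m ℓ s x := by simp [potential]

lemma neg_le_potential : -(m * (x + ℓ)) ≤ potential m ℓ s x := by simp [potential]

lemma continuous_potential : Continuous (potential m ℓ s) := by
  unfold potential
  fun_prop

lemma potential_eq_zero (hm : 0 ≤ m) (hs : 0 ≤ s) (h1 : -ℓ ≤ x) (h2 : x ≤ -s) :
    potential m ℓ s x = 0 := by
  have a : m / 2 * (x + s) ≤ 0 := by nlinarith
  have b : m * x ≤ 0 := by nlinarith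
  have c : -(m * (x + ℓ)) ≤ 0 := by nlinarith
  simp [potential, a, b, c]

lemma potential_eq_ramp (hm : 0 ≤ m) (hs : s ≤ ℓ) (h1 : -s ≤ x) (h2 : x ≤ 0) :
    potential m ℓ s x = m / 2 * (x + s) := by
  have a : 0 ≤ m / 2 * (x + s) := mul_nonneg (by linarith) (by linarith)
  have b : m * x ≤ 0 := by nlinarith
  have c : -(m * (x + ℓ)) ≤ 0 := by nlinarith
  rw [potential, max_eq_right a, max_eq_left]
  exact max_le (b.trans a) (c.trans a)

lemma convexOn_affine (k c : ℝ) : ConvexOn ℝ Set.univ fun x : ℝ => k * x + c :=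
  ⟨convex_univ, fun x _ y _ a b _ _ hab => le_of_eq (by
    simp only [smul_eq_mul]
    linear_combination -c * hab)⟩

lemma convexOn_potential : ConvexOn ℝ Set.univ (potential m ℓ s) := by
  have h := ((convexOn_affine 0 0).sup (convexOn_affine (m / 2) (m / 2 * s))).sup
    ((convexOn_affine m 0).sup (convexOn_affine (-m) (-(m * ℓ))))
  refine h.congr fun x _ => ?_
  simp only [potential, Pi.sup_apply]
  ring_nf

lemma abs_potential_sub_le (hm : 0 ≤ m) (y : ℝ) :
    |potential m ℓ s x - potential m ℓ s y| ≤ m * |x - y| := by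
  refine (abs_max_sub_max_le_max _ _ _ _).trans (max_le ?_ ?_) <;>
    refine (abs_max_sub_max_le_max _ _ _ _).trans (max_le ?_ ?_)
  · simp only [sub_self, abs_zero]; positivity
  · rw [show m / 2 * (x + s) - m / 2 * (y + s) = m / 2 * (x - y) by ring, abs_mul,
      abs_of_nonneg (by positivity : 0 ≤ m / 2)]
    nlinarith [abs_nonneg (x - y), mul_nonneg hm (abs_nonneg (x - y))]
  · rw [← mul_sub, abs_mul, abs_of_nonneg hm]
  · rw [show -(m * (x + ℓ)) - -(m * (y + ℓ)) = -(m * (x - y)) by ring, abs_neg, abs_mul,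
      abs_of_nonneg hm]

lemma potential_zero_le (hm : 0 ≤ m) (hs : 0 ≤ s) : potential m ℓ 0 x ≤ potential m ℓ s x := by
  unfold potential
  gcongr

/-- Among the affine pieces only the ramp depends on `s`, and it rises by `m * s / 2` from its
position at `s = 0`. -/
lemma potential_sub_le (hm : 0 ≤ m) (hs : 0 ≤ s) :
    potential m ℓ s x - potential m ℓ 0 x ≤ m * s / 2 := by
  have h0 : 0 ≤ potential m ℓ 0 x := potential_nonneg
  have h1 : m * x ≤ potential m ℓ 0 x := mul_le_potential
  have h2 : -(m * (x + ℓ)) ≤ potential m ℓ 0 x := neg_le_potential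
  have h3 : m / 2 * (x + 0) ≤ potential m ℓ 0 x := by simp [potential]
  have h4 : 0 ≤ m * s := mul_nonneg hm hs
  rw [sub_le_iff_le_add']
  exact max_le (max_le (by linarith) (by linarith)) (max_le (by linarith) (by linarith))

/-- The ramp is negative to the left of `-s` and lies below `m * x` to the right of `s`. This
confines the perturbation to length `2 * s`. -/
lemma potential_eq_of_not_mem (hm : 0 ≤ m) (hs : 0 ≤ s) (hx : x ∉ Set.Icc (-s) s) :
    potential m ℓ s x = potential m ℓ 0 x := by
  refine le_antisymm ?_ (potential_zero_le hm hs)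
  have h0 : 0 ≤ potential m ℓ 0 x := potential_nonneg
  have h1 : m * x ≤ potential m ℓ 0 x := mul_le_potential
  refine max_le (max_le h0 ?_) (max_le h1 neg_le_potential)
  rw [Set.mem_Icc, not_and_or, not_le, not_le] at hx
  rcases hx with hx | hx
  · exact le_trans (by nlinarith) h0
  · exact le_trans (by nlinarith) h1

end Potential

/-! ### Masses of the unnormalised density. -/

section Weight

variable {m ℓ s : ℝ}

open Set

lemma continuous_weight : Continuous fun x => Real.exp (-potential m ℓ s x) :=
  Real.continuous_exp.comp continuous_potential.neg

lemma weight_le_one (x : ℝ) : Real.exp (-potential m ℓ s x) ≤ 1 :=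
  Real.exp_le_one_iff.2 (neg_nonpos.2 potential_nonneg)

lemma integrableOn_weight_Ioi (hm : 0 < m) :
    IntegrableOn (fun x => Real.exp (-potential m ℓ s x)) (Ioi 0) := by
  refine (integrableOn_exp_mul_Ioi (neg_lt_zero.2 hm) 0).mono'
    continuous_weight.aestronglyMeasurable (.of_forall fun x => ?_)
  rw [Real.norm_of_nonneg (Real.exp_pos _).le, Real.exp_le_exp, neg_mul, neg_le_neg_iff]
  exact mul_le_potential

lemma integral_weight_Ioi_le (hm : 0 < m) :
    ∫ x in Ioi 0, Real.exp (-potential m ℓ s x) ≤ 1 / m := by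
  refine (setIntegral_mono (integrableOn_weight_Ioi hm)
    (integrableOn_exp_mul_Ioi (neg_lt_zero.2 hm) 0) fun x => ?_).trans_eq ?_
  · simp only [Real.exp_le_exp, neg_mul, neg_le_neg_iff]
    exact mul_le_potential
  · rw [integral_exp_mul_Ioi (neg_lt_zero.2 hm)]
    simp

lemma weight_le_left (x : ℝ) :
    Real.exp (-potential m ℓ s x) ≤ Real.exp (m * ℓ) * Real.exp (m * x) := by
  rw [← Real.exp_add, Real.exp_le_exp, neg_le]
  exact le_trans (by linarith) neg_le_potential

lemma integrableOn_weight_Iic (hm : 0 < m) :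
    IntegrableOn (fun x => Real.exp (-potential m ℓ s x)) (Iic (-ℓ)) := by
  refine ((integrableOn_exp_mul_Iic hm (-ℓ)).const_mul (Real.exp (m * ℓ))).mono'
    continuous_weight.aestronglyMeasurable (.of_forall fun x => ?_)
  rw [Real.norm_of_nonneg (Real.exp_pos _).le]
  exact weight_le_left x

lemma integral_weight_Iic_le (hm : 0 < m) :
    ∫ x in Iic (-ℓ), Real.exp (-potential m ℓ s x) ≤ 1 / m := by
  refine (setIntegral_mono (integrableOn_weight_Iic hm)
    ((integrableOn_exp_mul_Iic hm (-ℓ)).const_mul (Real.exp (m * ℓ)))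
    fun x => weight_le_left x).trans_eq ?_
  rw [integral_const_mul, integral_exp_mul_Iic hm, ← mul_div_assoc, ← Real.exp_add]
  simp

lemma integrableOn_weight_Ioc (a b : ℝ) :
    IntegrableOn (fun x => Real.exp (-potential m ℓ s x)) (Ioc a b) :=
  (continuous_weight.continuousOn.integrableOn_compact isCompact_Icc).mono_set Ioc_subset_Icc_self

lemma integral_weight_Ioc_le {a b : ℝ} (hab : a ≤ b) :
    ∫ x in Ioc a b, Real.exp (-potential m ℓ s x) ≤ b - a := by
  refine (setIntegral_mono (integrableOn_weight_Ioc a b)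
    (integrableOn_const (by simp)) weight_le_one).trans_eq ?_
  simp [hab]

lemma integral_weight_Ioi_neg_le (hm : 0 < m) {a : ℝ} (ha : 0 ≤ a) :
    ∫ x in Ioi (-a), Real.exp (-potential m ℓ s x) ≤ a + 1 / m := by
  rw [← Ioc_union_Ioi_eq_Ioi (neg_nonpos.2 ha), setIntegral_union (Ioc_disjoint_Ioi le_rfl)
    measurableSet_Ioi (integrableOn_weight_Ioc _ _) (integrableOn_weight_Ioi hm)]
  have := integral_weight_Ioc_le (m := m) (ℓ := ℓ) (s := s) (neg_nonpos.2 ha)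
  linarith [integral_weight_Ioi_le (m := m) (ℓ := ℓ) (s := s) hm]

lemma integrable_weight (hm : 0 < m) (hℓ : 0 ≤ ℓ) :
    Integrable fun x => Real.exp (-potential m ℓ s x) := by
  rw [← integrableOn_univ, ← Iic_union_Ioi (a := -ℓ),
    ← Ioc_union_Ioi_eq_Ioi (neg_nonpos.2 hℓ)]
  exact (integrableOn_weight_Iic hm).union
    ((integrableOn_weight_Ioc _ _).union (integrableOn_weight_Ioi hm))

lemma integral_weight_le (hm : 0 < m) (hℓ : 0 ≤ ℓ) :
    ∫ x, Real.exp (-potential m ℓ s x) ≤ ℓ + 2 / m := by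
  have h := integral_add_compl (measurableSet_Iic (a := -ℓ))
    (integrable_weight (s := s) hm hℓ)
  rw [compl_Iic] at h
  have h1 := integral_weight_Ioi_neg_le (ℓ := ℓ) (s := s) hm hℓ
  have h2 := integral_weight_Iic_le (ℓ := ℓ) (s := s) hm
  have h3 : 2 / m = 1 / m + 1 / m := by ring
  linarith

lemma le_integral_weight (hm : 0 < m) (hs : 0 ≤ s) (hsℓ : s ≤ ℓ) :
    ℓ - s ≤ ∫ x, Real.exp (-potential m ℓ s x) := by
  have h : ∫ x in Icc (-ℓ) (-s), Real.exp (-potential m ℓ s x) = ℓ - s := by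
    rw [setIntegral_congr_fun (g := fun _ => (1 : ℝ)) measurableSet_Icc fun x hx => by
      simp [potential_eq_zero hm.le hs hx.1 hx.2]]
    simp [hsℓ]
    ring
  rw [← h]
  exact setIntegral_le_integral (integrable_weight hm (hs.trans hsℓ))
    (.of_forall fun x => (Real.exp_pos _).le)

end Weight

/-! ### The normalised densities and their scores. -/

/-- The density proportional to the exponential of minus the potential. -/
def gibbs (m ℓ s x : ℝ) : ℝ :=
  Real.exp (-potential m ℓ s x) / ∫ y, Real.exp (-potential m ℓ s y)

section Gibbs

variable {m ℓ s : ℝ}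

open Set

lemma integral_weight_pos (hm : 0 < m) (hℓ : 0 ≤ ℓ) :
    0 < ∫ x, Real.exp (-potential m ℓ s x) :=
  integral_exp_pos (integrable_weight hm hℓ)

lemma isPositiveDensity_gibbs (hm : 0 < m) (hℓ : 0 ≤ ℓ) : IsPositiveDensity (gibbs m ℓ s) where
  pos x := div_pos (Real.exp_pos _) (integral_weight_pos hm hℓ)
  continuous := continuous_weight.div_const _
  integrable := (integrable_weight hm hℓ).div_const _
  integral_eq_one := by
    unfold gibbs
    rw [integral_div, div_self (integral_weight_pos hm hℓ).ne']

lemma log_gibbs (hm : 0 < m) (hℓ : 0 ≤ ℓ) (x : ℝ) : Real.log (gibbs m ℓ s x)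
    = -potential m ℓ s x - Real.log (∫ y, Real.exp (-potential m ℓ s y)) := by
  rw [gibbs, Real.log_div (Real.exp_pos _).ne' (integral_weight_pos hm hℓ).ne', Real.log_exp]

lemma abs_realScore_gibbs_le (hm : 0 < m) (hℓ : 0 ≤ ℓ) (x : ℝ) :
    |realScore (gibbs m ℓ s) x| ≤ m := by
  refine abs_derivWithin_Ioi_le hm.le (fun y z => ?_) x
  rw [log_gibbs hm hℓ, log_gibbs hm hℓ, abs_sub_comm y z]
  have := abs_potential_sub_le (ℓ := ℓ) (s := s) (x := z) hm.le y
  convert this using 2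
  ring

lemma realScore_gibbs_eq_zero (hm : 0 < m) (hℓ : 0 ≤ ℓ) (hs : 0 ≤ s) {x : ℝ}
    (hx : x ∈ Ico (-ℓ) (-s)) : realScore (gibbs m ℓ s) x = 0 := by
  refine derivWithin_Ioi_eq_of_affine
    (c := -Real.log (∫ y, Real.exp (-potential m ℓ s y))) hx.2 fun y hy => ?_
  rw [log_gibbs hm hℓ, potential_eq_zero hm.le hs (hx.1.trans hy.1) hy.2.le]
  ring

lemma realScore_gibbs_ramp (hm : 0 < m) (hℓ : 0 ≤ ℓ) (hs : s ≤ ℓ) {x : ℝ}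
    (hx : x ∈ Ico (-s) 0) : realScore (gibbs m ℓ s) x = -(m / 2) := by
  refine derivWithin_Ioi_eq_of_affine
    (c := -(m / 2 * s) - Real.log (∫ y, Real.exp (-potential m ℓ s y))) hx.2 fun y hy => ?_
  rw [log_gibbs hm hℓ, potential_eq_ramp hm.le hs (hx.1.trans hy.1) hy.2.le]
  ring

lemma concaveOn_log_gibbs (hm : 0 < m) (hℓ : 0 ≤ ℓ) :
    ConcaveOn ℝ univ fun x => Real.log (gibbs m ℓ s x) := by
  have h := (convexOn_potential (m := m) (ℓ := ℓ) (s := s)).neg.add_const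
    (-Real.log (∫ y, Real.exp (-potential m ℓ s y)))
  refine h.congr fun x _ => ?_
  rw [log_gibbs hm hℓ]
  simp [sub_eq_add_neg]

lemma gibbs_mem_tailClassFisher {v γ L r : ℝ} (hm : 0 < m) (hv : 0 < v) (hv1 : v ≤ 1)
    (hℓ : m * ℓ * v = 6) (hs : 0 ≤ s) (hsm : s * m ≤ 1) (hγ : γ ≤ 1) (hL : 0 ≤ L)
    (hmL : m ≤ L / v ^ ((1 - γ) / 2)) (hmr : 2 * v * m ^ 2 ≤ r) :
    gibbs m ℓ s ∈ tailClassFisher γ L r := by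
  have hmℓ : 6 ≤ m * ℓ := by
    by_contra! h
    nlinarith
  have hℓ0 : 0 < ℓ := by
    by_contra! h
    nlinarith
  have hsℓ : s ≤ ℓ := by nlinarith
  have hZ := le_integral_weight hm hs hsℓ
  have hZ0 := integral_weight_pos (s := s) hm hℓ0.le
  have hs' : s ≤ 1 / m := by rwa [le_div_iff₀ hm]
  have hbound : 3 / m ≤ v * ∫ y, Real.exp (-potential m ℓ s y) := by
    have h1 : v * (ℓ - s) ≤ v * ∫ y, Real.exp (-potential m ℓ s y) :=
      mul_le_mul_of_nonneg_left hZ hv.le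
    refine le_trans ?_ h1
    rw [div_le_iff₀ hm]
    nlinarith
  -- With total weight `Z`, the choice `m * ℓ * v = 6` gives `v * Z ≥ 3 / m`. The left tail weighs
  -- at most `1 / m`, and the part beyond `-(2 / m)` at most `2 / m + 1 / m`. As `s ≤ 1 / m`, the
  -- point `-(2 / m)` lies strictly before `-s`.
  refine (isPositiveDensity_gibbs hm hℓ0.le).mem_tailClassFisher (p := -ℓ) (q := -s)
    (q' := -(2 / m)) (concaveOn_log_gibbs hm hℓ0.le) ?_ hv ?_ ?_
    (fun x hx => realScore_gibbs_eq_zero hm hℓ0.le hs hx)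
    (abs_realScore_gibbs_le hm hℓ0.le) hγ hL hmL hmr
  · have : 2 / m = 1 / m + 1 / m := by ring
    have : 0 < 1 / m := by positivity
    linarith
  · unfold gibbs
    rw [integral_div, div_le_iff₀ hZ0]
    refine (integral_weight_Iic_le hm).trans (le_trans ?_ hbound)
    gcongr
    norm_num
  · unfold gibbs
    rw [integral_div, div_le_iff₀ hZ0]
    refine (integral_weight_Ioi_neg_le hm (by positivity)).trans (le_trans (le_of_eq ?_) hbound)
    ring

end Gibbs

/-! ### Affinity and separation of the two densities. -/

section TwoPoint

variable {m ℓ s : ℝ}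

open Set

/-- The Hellinger affinity of the two densities, one with and one without the cut kink. -/
lemma one_sub_le_sq_affinity_gibbs (hm : 0 < m) (hℓ : 0 ≤ ℓ) (hs : 0 ≤ s) :
    1 - m ^ 2 * s ^ 3 / 8 / (∫ x, Real.exp (-potential m ℓ s x))
      ≤ (∫ x, √(gibbs m ℓ 0 x * gibbs m ℓ s x)) ^ 2 := by
  set Z0 := ∫ x, Real.exp (-potential m ℓ 0 x) with hZ0
  set Z1 := ∫ x, Real.exp (-potential m ℓ s x) with hZ1
  have p0 : 0 < Z0 := integral_weight_pos hm hℓ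
  have p1 : 0 < Z1 := integral_weight_pos hm hℓ
  set k : ℝ → ℝ := fun x => Real.exp (-(potential m ℓ s x - potential m ℓ 0 x) / 2) with hk
  set p : ℝ → ℝ := fun x => Real.exp (-potential m ℓ 0 x) with hp
  have hpint : Integrable p := integrable_weight hm hℓ
  have hq : ∀ x, p x * k x ^ 2 = Real.exp (-potential m ℓ s x) := fun x => by
    rw [hp, hk, ← Real.exp_nat_mul, ← Real.exp_add]
    congr 1
    push_cast
    ring
  have hqint : Integrable fun x => p x * k x ^ 2 := by
    simp_rw [hq]
    exact integrable_weight hm hℓ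
  have hk1 : ∀ x, k x ≤ 1 := fun x =>
    Real.exp_le_one_iff.2 (by linarith [potential_zero_le (ℓ := ℓ) (x := x) hm.le hs])
  have hk0 : ∀ x, 0 ≤ k x := fun x => (Real.exp_pos _).le
  have hp0 : ∀ x, 0 ≤ p x := fun x => (Real.exp_pos _).le
  have hkc : Continuous k :=
    Real.continuous_exp.comp ((continuous_potential.sub continuous_potential).neg.div_const 2)
  have hpk : Integrable fun x => p x * k x := by
    refine hpint.mono' (continuous_weight.mul hkc).aestronglyMeasurable (.of_forall fun x => ?_)
    rw [Real.norm_of_nonneg (mul_nonneg (hp0 x) (hk0 x))]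
    exact mul_le_of_le_one_right (hp0 x) (hk1 x)
  -- The integrand is at most `(m * s / 4) ^ 2` on an interval of length `2 * s` and zero elsewhere.
  have hrem : ∫ x, p x * (1 - k x) ^ 2 ≤ m ^ 2 * s ^ 3 / 8 := by
    have hb : ∀ x, p x * (1 - k x) ^ 2
        ≤ (Icc (-s) s).indicator (fun _ => (m * s / 4) ^ 2) x := by
      intro x
      by_cases hx : x ∈ Icc (-s) s
      · rw [indicator_of_mem hx]
        have h1 : 1 - k x ≤ m * s / 4 := by
          have h2 := Real.add_one_le_exp (-(potential m ℓ s x - potential m ℓ 0 x) / 2)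
          have h3 := potential_sub_le (ℓ := ℓ) (x := x) hm.le hs
          simp only [hk]
          linarith
        have h4 : (1 - k x) ^ 2 ≤ (m * s / 4) ^ 2 :=
          pow_le_pow_left₀ (sub_nonneg.2 (hk1 x)) h1 2
        exact (mul_le_of_le_one_left (sq_nonneg _) (weight_le_one x)).trans h4
      · rw [indicator_of_notMem hx]
        simp [hk, potential_eq_of_not_mem hm.le hs hx]
    have hi : Integrable ((Icc (-s) s).indicator fun _ : ℝ => (m * s / 4) ^ 2) :=
      (integrable_indicator_iff measurableSet_Icc).2 (integrableOn_const (by simp))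
    refine (integral_mono_of_nonneg (.of_forall fun x => mul_nonneg (hp0 x) (sq_nonneg _)) hi
      (.of_forall hb)).trans_eq ?_
    rw [integral_indicator measurableSet_Icc]
    simp [hs]
    ring
  have hexp : ∫ x, p x * (1 - k x) ^ 2 = Z0 - 2 * (∫ x, p x * k x) + Z1 := by
    have e : ∀ x, p x * (1 - k x) ^ 2 = (p x - 2 * (p x * k x)) + p x * k x ^ 2 := fun x => by ring
    simp_rw [e]
    have hd : Integrable fun x => p x - 2 * (p x * k x) := hpint.sub (hpk.const_mul 2)
    rw [integral_add hd hqint, integral_sub hpint (hpk.const_mul 2), integral_const_mul]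
    simp_rw [hq]
    rfl
  have haff : ∫ x, √(gibbs m ℓ 0 x * gibbs m ℓ s x) = (∫ x, p x * k x) / √(Z0 * Z1) := by
    rw [← integral_div]
    refine integral_congr_ae (.of_forall fun x => ?_)
    have e : gibbs m ℓ 0 x * gibbs m ℓ s x = (p x * k x) ^ 2 / (Z0 * Z1) := by
      rw [gibbs, gibbs, ← hq, ← hZ0, ← hZ1, div_mul_div_comm]
      congr 1
      simp only [hp]
      ring
    simp only [e]
    rw [Real.sqrt_div (sq_nonneg _), Real.sqrt_sq (mul_nonneg (hp0 x) (hk0 x))]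
  rw [haff, div_pow, Real.sq_sqrt (mul_pos p0 p1).le, le_div_iff₀ (mul_pos p0 p1)]
  have e : (1 - m ^ 2 * s ^ 3 / 8 / Z1) * (Z0 * Z1) = Z0 * Z1 - Z0 * (m ^ 2 * s ^ 3 / 8) := by
    field_simp
  rw [e]
  -- With `A = ∫ p * k`, use `A ^ 2 ≥ 2 * A * Z0 - Z0 ^ 2` and substitute `2 * A` from `hexp`. The
  -- terms in `Z0 ^ 2` cancel, so `Z0` and `Z1` need not be compared.
  nlinarith [sq_nonneg ((∫ x, p x * k x) - Z0), mul_le_mul_of_nonneg_left hrem p0.le]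

/-- The normalising constant is at most `ℓ + 2 / m ≤ 8 / (m * v)`, and the weight is at least `1 /
2`. -/
lemma le_gibbs {v : ℝ} (hm : 0 < m) (hℓ : 0 ≤ ℓ) (hv : 0 < v) (hv1 : v ≤ 1)
    (hℓv : m * ℓ * v = 6) {x : ℝ} (hx : potential m ℓ s x ≤ 1 / 2) :
    m * v / 16 ≤ gibbs m ℓ s x := by
  have hZ0 := integral_weight_pos (s := s) hm hℓ
  have hZ : ∫ x, Real.exp (-potential m ℓ s x) ≤ 8 / (m * v) := by
    refine (integral_weight_le hm hℓ).trans ?_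
    rw [le_div_iff₀ (by positivity), add_mul, div_mul_eq_mul_div, mul_left_comm,
      mul_div_assoc, mul_div_cancel_left₀ _ hm.ne']
    nlinarith
  rw [gibbs, le_div_iff₀ hZ0]
  calc m * v / 16 * ∫ x, Real.exp (-potential m ℓ s x) ≤ m * v / 16 * (8 / (m * v)) := by gcongr
    _ = 1 / 2 := by field_simp; norm_num
    _ ≤ Real.exp (-potential m ℓ s x) := by
        linarith [Real.add_one_le_exp (-potential m ℓ s x)]

lemma separation_gibbs {v : ℝ} (hm : 0 < m) (hv : 0 < v) (hv1 : v ≤ 1)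
    (hℓ : m * ℓ * v = 6) (hsm : s * m ≤ 1) {e : ℝ → ℝ} (he : Measurable e) :
    2 * ENNReal.ofReal (m ^ 2 * v * (s * m) / 256)
      ≤ loss e (gibbs m ℓ 0) + loss e (gibbs m ℓ s) := by
  have hmℓ : 6 ≤ m * ℓ := by
    by_contra! h
    nlinarith
  have hℓ0 : 0 ≤ ℓ := by
    by_contra! h
    nlinarith
  have hsℓ : s ≤ ℓ := by nlinarith
  have key := separation_le_loss_add_loss (a := -s) (b := 0) (D := m / 2) (B := m * v / 16)
    (isPositiveDensity_gibbs (s := 0) hm hℓ0).pos (isPositiveDensity_gibbs (s := s) hm hℓ0).pos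
    (isPositiveDensity_gibbs (s := s) hm hℓ0).continuous.measurable
    (by positivity) (by positivity) (fun x hx => ?_) (fun x hx => ?_) (fun x hx => ?_) he
  · refine le_trans (le_of_eq ?_) key
    rw [← ENNReal.ofReal_ofNat, ← ENNReal.ofReal_mul (by norm_num)]
    congr 1
    ring
  · rw [realScore_gibbs_eq_zero hm hℓ0 le_rfl ⟨by linarith [hx.1], by linarith [hx.2]⟩,
      realScore_gibbs_ramp hm hℓ0 hsℓ ⟨hx.1.le, hx.2⟩, zero_sub, neg_neg, abs_of_pos (by positivity)]
  · refine le_gibbs hm hℓ0 hv hv1 hℓ ?_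
    rw [potential_eq_zero hm.le le_rfl (by linarith [hx.1]) (by linarith [hx.2])]
    norm_num
  · refine le_gibbs hm hℓ0 hv hv1 hℓ ?_
    rw [potential_eq_ramp hm.le hsℓ hx.1.le hx.2.le]
    nlinarith [hx.1, hx.2]

end TwoPoint

/-! ### Tuning the parameters. -/

/-- The right side is `δ ^ (1 / 6)`; sixth powers make the comparison polynomial, and `δ * (1 - δ) ≤
3 / 16` suffices. -/
lemma four_mul_mul_one_sub_lt {δ : ℝ} (h0 : 0 < δ) (h1 : δ ≤ 1 / 4) :
    4 * δ * (1 - δ) < Real.exp (-(Real.log (1 / δ) / 6)) := by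
  have e : Real.exp (-(Real.log (1 / δ) / 6)) ^ 6 = δ := by
    rw [← Real.exp_nat_mul, one_div, Real.log_inv]
    push_cast
    rw [show 6 * -(-Real.log δ / 6) = Real.log δ by ring, Real.exp_log h0]
  refine lt_of_pow_lt_pow_left₀ 6 (Real.exp_pos _).le ?_
  rw [e]
  have h2 : 0 ≤ δ * (1 - δ) := mul_nonneg h0.le (by linarith)
  have h3 : δ * (1 - δ) ≤ 3 / 16 := by nlinarith
  have h4 : 4096 * (δ * (1 - δ)) ^ 5 < 1 :=
    (mul_le_mul_of_nonneg_left (pow_le_pow_left₀ h2 h3 5) (by norm_num)).trans_lt (by norm_num)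
  have h5 : (4 * δ * (1 - δ)) ^ 6 = 4096 * (δ * (1 - δ)) ^ 5 * (1 - δ) * δ := by ring
  rw [h5]
  refine mul_lt_of_lt_one_left h0 ?_
  have h6 : 0 ≤ 4096 * (δ * (1 - δ)) ^ 5 := by positivity
  nlinarith

/-- The lower bounds obtained from a perturbation of relative width `h` at the quantile
level `v`. -/
lemma minimax_lower_bound {γ L r v h : ℝ} (hγ1 : γ ≤ 1) (hL : 0 < L) (hv : 0 < v) (hv1 : v ≤ 1)
    (hr : L ^ 2 * v ^ γ ≤ r) (hh : 0 < h) (hh1 : h ≤ 1) {n : ℕ} {δ : ℝ} (hδ0 : 0 < δ)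
    (hδ : δ ≤ 1 / 4) (hn : n * (h ^ 3 * v) ≤ Real.log (1 / δ)) :
    ENNReal.ofReal (L ^ 2 * v ^ γ * h / 1024) ≤ minimaxQuantile n δ (tailClassFisher γ L r) ∧
    ENNReal.ofReal δ * ENNReal.ofReal (L ^ 2 * v ^ γ * h / 1024)
      ≤ minimaxRisk n (tailClassFisher γ L r) := by
  have hvp : 0 < v ^ ((1 - γ) / 2) := Real.rpow_pos_of_pos hv _
  -- Half the largest slope allowed by the tail condition, so that the Fisher information bound `2 *
  -- v * m ^ 2` equals `L ^ 2 * v ^ γ / 2`.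
  set m := L / 2 / v ^ ((1 - γ) / 2) with hmdef
  have hm : 0 < m := by positivity
  have hm2 : m ^ 2 * v = L ^ 2 * v ^ γ / 4 := by
    have e : (v ^ ((1 - γ) / 2)) ^ 2 * v ^ γ = v := by
      rw [← Real.rpow_natCast, ← Real.rpow_mul hv.le, ← Real.rpow_add hv]
      norm_num
    have e' : v = (v ^ ((1 - γ) / 2)) ^ 2 * v ^ γ := e.symm
    rw [hmdef, div_pow, div_mul_eq_mul_div, div_eq_iff (by positivity)]
    linear_combination (L ^ 2 / 4) * e'
  set ℓ := 6 / (m * v) with hℓdef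
  have hℓ0 : 0 ≤ ℓ := by positivity
  have hℓ : m * ℓ * v = 6 := by rw [hℓdef]; field_simp
  set s := h / m with hsdef
  have hs : 0 ≤ s := by positivity
  have hsm : s * m = h := div_mul_cancel₀ _ hm.ne'
  have hmL : m ≤ L / v ^ ((1 - γ) / 2) := by
    rw [hmdef]; gcongr; linarith
  have hpow : 0 < v ^ γ := Real.rpow_pos_of_pos hv _
  have hmr : 2 * v * m ^ 2 ≤ r := by
    have : 0 ≤ L ^ 2 * v ^ γ := by positivity
    linarith
  have hT : m ^ 2 * v * (s * m) / 256 = L ^ 2 * v ^ γ * h / 1024 := by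
    rw [hm2, hsm]; ring
  have hf := isPositiveDensity_gibbs (s := 0) hm hℓ0
  have hg := isPositiveDensity_gibbs (s := s) hm hℓ0
  have hfG : gibbs m ℓ 0 ∈ tailClassFisher γ L r :=
    gibbs_mem_tailClassFisher hm hv hv1 hℓ le_rfl (by simp) hγ1 hL.le hmL hmr
  have hgG : gibbs m ℓ s ∈ tailClassFisher γ L r :=
    gibbs_mem_tailClassFisher hm hv hv1 hℓ hs (hsm.trans_le hh1) hγ1 hL.le hmL hmr
  have hsep : ∀ e : ℝ → ℝ, Measurable e → 2 * ENNReal.ofReal (L ^ 2 * v ^ γ * h / 1024)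
      ≤ loss e (gibbs m ℓ 0) + loss e (gibbs m ℓ s) := fun e he => by
    rw [← hT]
    exact separation_gibbs hm hv hv1 hℓ (hsm.trans_le hh1) he
  have hy0 : 0 ≤ h ^ 3 * v := by positivity
  have hy1 : h ^ 3 * v ≤ 1 := mul_le_one₀ (pow_le_one₀ hh.le hh1) hv.le hv1
  -- With `y = h ^ 3 * v ≤ 1`, the chain is `exp (-y / 6) ≤ 1 / (1 + y / 6) ≤ 1 - y / 40`. The `40`
  -- is `8 * 5`, from `m ^ 2 * s ^ 3 / 8` and `Z ≥ 5 / (m * v)`.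
  have haff : Real.exp (-(h ^ 3 * v / 6)) ≤ (∫ x, √(gibbs m ℓ 0 x * gibbs m ℓ s x)) ^ 2 := by
    refine le_trans ?_ (one_sub_le_sq_affinity_gibbs hm hℓ0 hs)
    have hmℓ : 6 ≤ m * ℓ := by
      by_contra! h
      nlinarith
    have hsℓ : s ≤ ℓ := by nlinarith
    have hZ : 5 / (m * v) ≤ ∫ x, Real.exp (-potential m ℓ s x) := by
      refine le_trans ?_ (le_integral_weight hm hs hsℓ)
      rw [div_le_iff₀ (by positivity)]
      have : s * m * v ≤ 1 := by rw [hsm]; exact mul_le_one₀ hh1 hv.le hv1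
      linarith
    have hq : m ^ 2 * s ^ 3 / 8 / (∫ x, Real.exp (-potential m ℓ s x)) ≤ h ^ 3 * v / 40 := by
      rw [div_le_iff₀ (lt_of_lt_of_le (by positivity) hZ)]
      refine le_trans (le_of_eq ?_) (mul_le_mul_of_nonneg_left hZ (by positivity))
      rw [hsdef]
      field_simp
      norm_num
    have hexp : Real.exp (-(h ^ 3 * v / 6)) ≤ 1 / (1 + h ^ 3 * v / 6) := by
      rw [Real.exp_neg, ← one_div]
      exact one_div_le_one_div_of_le (by positivity)
        (by linarith [Real.add_one_le_exp (h ^ 3 * v / 6)])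
    refine hexp.trans (le_trans ?_ (sub_le_sub_left hq 1))
    rw [div_le_iff₀ (by positivity)]
    nlinarith
  have hpn : 4 * δ * (1 - δ) < ((∫ x, √(gibbs m ℓ 0 x * gibbs m ℓ s x)) ^ 2) ^ n := by
    refine (four_mul_mul_one_sub_lt hδ0 hδ).trans_le (le_trans ?_
      (pow_le_pow_left₀ (Real.exp_pos _).le haff n))
    rw [← Real.exp_nat_mul, Real.exp_le_exp]
    linarith
  exact ⟨hf.le_minimaxQuantile hg (by linarith) hpn hsep hfG hgG,
    hf.le_minimaxRisk hg hδ0 (by linarith) hpn hsep hfG hgG⟩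

/-- The choice of the level and of the relative width that yields the minimax rate. -/
lemma exists_level_width {γ x w : ℝ} (hx : 0 < x) (hw : 0 < w) :
    ∃ v h : ℝ, 0 < v ∧ v ≤ w ∧ 0 < h ∧ h ≤ 1 ∧ h ^ 3 * v ≤ x ∧
      w ^ γ * min ((1 / w * x) ^ (min γ (1 / 3))) 1 ≤ v ^ γ * h := by
  have hxw : 1 / w * x = x / w := by ring
  rw [hxw]
  -- On the curve `h ^ 3 * v = x` the objective is `x ^ (1 / 3) * v ^ (γ - 1 / 3)`. Hence `γ ≤ 1 /
  -- 3` favours small `v` with full width `h = 1`, and `γ ≥ 1 / 3` favours the largest level `v =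
  -- w`.
  rcases le_total γ (1 / 3) with hγ | hγ
  · rw [min_eq_left hγ]
    refine ⟨min x w, 1, lt_min hx hw, min_le_right _ _, one_pos, le_rfl, by simp, ?_⟩
    rw [mul_one]
    rcases le_total x w with h | h
    · rw [min_eq_left h, Real.div_rpow hx.le hw.le]
      refine (mul_le_mul_of_nonneg_left (min_le_left _ _) (by positivity)).trans_eq ?_
      rw [mul_div_cancel₀]
      exact (Real.rpow_pos_of_pos hw _).ne'
    · rw [min_eq_right h]
      exact mul_le_of_le_one_right (by positivity) (min_le_right _ _)
  · rw [min_eq_right hγ]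
    have hp : 0 < (x / w) ^ (1 / 3 : ℝ) := Real.rpow_pos_of_pos (by positivity) _
    refine ⟨w, min ((x / w) ^ (1 / 3 : ℝ)) 1, hw, le_rfl, lt_min hp one_pos, min_le_right _ _, ?_,
      le_rfl⟩
    have h3 : (min ((x / w) ^ (1 / 3 : ℝ)) 1) ^ 3 ≤ ((x / w) ^ (1 / 3 : ℝ)) ^ 3 :=
      pow_le_pow_left₀ (le_min hp.le zero_le_one) (min_le_left _ _) 3
    rw [← Real.rpow_natCast ((x / w) ^ (1 / 3 : ℝ)), ← Real.rpow_mul (by positivity)] at h3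
    norm_num at h3
    rwa [le_div_iff₀ hw] at h3

end ScoreEstimation

end

theorem theorem3 (γ : ℝ) (hγ0 : 0 < γ) (hγ1 : γ ≤ 1) :
    ∃ c : ℝ, 0 < c ∧ ∀ (n : ℕ) (L r : ℝ), 1 ≤ n → 0 < L → 0 < r →
      (∀ δ : ℝ, 0 < δ → δ ≤ 1 / 4 →
        ENNReal.ofReal (c * (min r (L ^ 2) *
            min ((L ^ (2 / γ) / (min r (L ^ 2)) ^ (1 / γ) * (Real.log (1 / δ) / (n : ℝ)))
              ^ (min γ (1 / 3))) 1))
          ≤ ScoreEstimation.minimaxQuantile n δ (ScoreEstimation.tailClassFisher γ L r)) ∧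
      ENNReal.ofReal (c * (min r (L ^ 2) *
          min ((L ^ (2 / γ) / (min r (L ^ 2)) ^ (1 / γ) * (1 / (n : ℝ)))
            ^ (min γ (1 / 3))) 1))
        ≤ ScoreEstimation.minimaxRisk n (ScoreEstimation.tailClassFisher γ L r) := by
  -- The constant is absolute: `1 / 1024` from the two-point bound, times `1 / 4` from Markov's
  -- inequality at `δ = 1 / 4`.
  refine ⟨1 / 4096, by norm_num, fun n L r hn hL hr => ?_⟩
  have hn0 : (0 : ℝ) < n := by exact_mod_cast hn
  set R := min r (L ^ 2) with hR
  have hR0 : 0 < R := lt_min hr (by positivity)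
  -- The level at which `L ^ 2 * w ^ γ = R`; every `v ≤ w` then respects the Fisher information
  -- constraint.
  set w : ℝ := (R / L ^ 2) ^ (1 / γ) with hw
  have hw0 : 0 < w := Real.rpow_pos_of_pos (by positivity) _
  have hw1 : w ≤ 1 := Real.rpow_le_one (by positivity)
    ((div_le_one (by positivity)).2 (min_le_right _ _)) (by positivity)
  have hwγ : w ^ γ = R / L ^ 2 := by
    rw [hw, ← Real.rpow_mul (by positivity), one_div_mul_cancel hγ0.ne', Real.rpow_one]
  have hratio : L ^ (2 / γ) / R ^ (1 / γ) = 1 / w := by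
    rw [hw, Real.div_rpow hR0.le (by positivity), one_div_div, ← Real.rpow_natCast L 2,
      ← Real.rpow_mul hL.le]
    congr 2
    push_cast
    ring
  have hlog : ∀ δ : ℝ, 0 < δ → δ ≤ 1 / 4 → 1 ≤ Real.log (1 / δ) := fun δ h0 h1 => by
    rw [Real.le_log_iff_exp_le (by positivity), le_div_iff₀ h0]
    nlinarith [Real.exp_one_lt_d9]
  have key : ∀ δ x : ℝ, 0 < δ → δ ≤ 1 / 4 → 0 < x → n * x ≤ Real.log (1 / δ) →
      ENNReal.ofReal (R * min ((L ^ (2 / γ) / R ^ (1 / γ) * x) ^ (min γ (1 / 3))) 1 / 1024)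
        ≤ ScoreEstimation.minimaxQuantile n δ (ScoreEstimation.tailClassFisher γ L r) ∧
      ENNReal.ofReal δ * ENNReal.ofReal
          (R * min ((L ^ (2 / γ) / R ^ (1 / γ) * x) ^ (min γ (1 / 3))) 1 / 1024)
        ≤ ScoreEstimation.minimaxRisk n (ScoreEstimation.tailClassFisher γ L r) := by
    intro δ x hδ0 hδ1 hx hnx
    obtain ⟨v, h, hv, hvw, hh, hh1, h3, hle⟩ :=
      ScoreEstimation.exists_level_width (γ := γ) hx hw0
    have hLR : L ^ 2 * w ^ γ = R := by rw [hwγ]; field_simp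
    have hvR : L ^ 2 * v ^ γ ≤ r := by
      refine le_trans ?_ (min_le_left r (L ^ 2))
      rw [← hR, ← hLR]
      gcongr
    have hmono : ENNReal.ofReal
        (R * min ((L ^ (2 / γ) / R ^ (1 / γ) * x) ^ (min γ (1 / 3))) 1 / 1024)
        ≤ ENNReal.ofReal (L ^ 2 * v ^ γ * h / 1024) := by
      refine ENNReal.ofReal_le_ofReal ?_
      rw [hratio, ← hLR, mul_assoc, mul_assoc]
      gcongr
    have hb := ScoreEstimation.minimax_lower_bound hγ1 hL hv (hvw.trans hw1) hvR hh hh1 hδ0 hδ1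
      ((mul_le_mul_of_nonneg_left h3 hn0.le).trans hnx)
    exact ⟨hmono.trans hb.1, (mul_le_mul_right hmono _).trans hb.2⟩
  refine ⟨fun δ hδ0 hδ1 => ?_, ?_⟩
  · have hl := hlog δ hδ0 hδ1
    have hx : 0 < Real.log (1 / δ) / n := by positivity
    refine le_trans (ENNReal.ofReal_le_ofReal ?_)
      (key δ (Real.log (1 / δ) / n) hδ0 hδ1 hx (mul_div_cancel₀ _ hn0.ne').le).1
    have : 0 ≤ R * min ((L ^ (2 / γ) / R ^ (1 / γ) * (Real.log (1 / δ) / n))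
        ^ (min γ (1 / 3))) 1 := by positivity
    linarith
  -- The risk bound takes `δ = 1 / 4` and `x = 1 / n`, admissible because `log 4 ≥ 1`.
  · refine le_trans (le_of_eq ?_) (key (1 / 4) (1 / n) (by norm_num) le_rfl (by positivity)
      ((mul_one_div_cancel hn0.ne').trans_le (hlog _ (by norm_num) le_rfl))).2
    rw [← ENNReal.ofReal_mul (by norm_num)]
    congr 1
    ring
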